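/- All topological spaces are Hausdorff and all Banach spaces are real and nonzero. For a compact space $K$ and a Banach space $E$, $\mathcal C(K,E)$ is the Banach space of continuous functions $K\to E$ with the supremum norm. For a topological space $S$ put $S^{(0)}=S$, let $S^{(\alpha+1)}$ be the set of accumulation points of the space $S^{(\alpha)}$, and $S^{(\alpha)}=\bigcap_{\beta<\alpha}S^{(\beta)}$ for limit ordinals $\alpha$; $S$ is scattered if $S^{(\alpha)}=\emptyset$ for some ordinal $\alpha$, and the least such $\alpha$ is the height $ht(S)$ of $S$. A statement about $ht(S)$ includes that $S$ is scattered. An into isomorphism is a linear homeomorphism $T$ onto a linear subspace of the target space; $T^{-1}$ is defined on the range of $T$, and $\|T\|$, $\|T^{-1}\|$ are operator norms. A Banach space contains an isomorphic copy of $X$ ($X$ embeds isomorphically into it) if there is an into isomorphism from $X$ to it; $c_0$ is the space of real null sequences with the supremum norm. Let $K_1,K_2$ be infinite compact spaces and let $E_1,E_2$ be Banach spaces such that $E_2$ does not contain an isomorphic copy of $c_0$. (i) If $l,k\in\mathbb N$, $l>k$, $ht(K_1)=l$, $ht(K_2)=k$, and $T:\mathcal C(K_1,E_1)\to\mathcal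 C(K_2,E_2)$ is an into isomorphism, then $$\|T\|\,\|T^{-1}\|\ \ge\ \max\Big\{3,\ \frac{2l-k-1}{k-1}\Big\}.$$ (Here $k\ge 2$, because $K_2$ is infinite and compact.) (ii) If $\mathcal C(K_1,E_1)$ embeds isomorphically into $\mathcal C(K_2,E_2)$ and $ht(K_2)$ is finite, then $ht(K_1)$ is finite. -/

import Mathlib

open scoped ZeroAtInfty CantorBendixson

/-- A topological space `S` is scattered if some transfinite derivative of `S` is empty.
Here `Set.univᵈ[α]` is the `α`-th Cantor–Bendixson derivative of the whole space: the whole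
space at `0`, the accumulation points of the previous stage at successors, and the intersection of
the earlier stages at limits. -/
def IsScatteredSpace (S : Type*) [TopologicalSpace S] : Prop :=
  ∃ α : Ordinal, (Set.univ : Set S)ᵈ[α] = ∅

/-- The height of a scattered space `S`: the least ordinal `α` such that the `α`-th derivative of
`S` is empty. It is only meaningful together with `IsScatteredSpace S`. -/
noncomputable def scatteredHeight (S : Type*) [TopologicalSpace S] : Ordinal :=
  sInf {α : Ordinal | (Set.univ : Set S)ᵈ[α] = ∅}

/-- `X` embeds isomorphically into `Y`, that is, `Y` contains an isomorphic copy of `X`: there is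
a linear homeomorphism of `X` onto a linear subspace of `Y`. -/
def EmbedsIsomorphically (X Y : Type*) [NormedAddCommGroup X] [NormedSpace ℝ X]
    [NormedAddCommGroup Y] [NormedSpace ℝ Y] : Prop :=
  ∃ H : Submodule ℝ Y, Nonempty (X ≃L[ℝ] H)

/-- `Y` contains an isomorphic copy of `c₀`, the Banach space `C₀(ℕ, ℝ)` of real null sequences
with the supremum norm. -/
def ContainsCopyOfCZero (Y : Type*) [NormedAddCommGroup Y] [NormedSpace ℝ Y] : Prop :=
  EmbedsIsomorphically C₀(ℕ, ℝ) Y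

/-!
Restrict an into isomorphism `T` to an operator `S` on the scalar functions `C(K₁, ℝ)`, and let
`m + 1` and `k` be the heights of `K₁` and `K₂`. A point of the `m`-th derivative of `K₁` lets us
choose `m` successive bumps `g`, each equal to `1` near the points where the later ones live, and at
each stage there are infinitely many candidates with disjoint supports. As `E₂` does not contain
`c₀`, by the theorems of Rosenthal and Bessaga–Pełczyński only finitely many of the candidates have
a large image under `S` at any given point of `K₂`. So at each stage either some candidate has a
small image at the relevant point, or that point is close to one lying a derivative deeper in `K₂`.
As the `k`-th derivative of `K₂` is empty, fewer than `k` of the bumps are large at the point where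
a prescribed combination of them attains the norm of its image. Testing with `1 + 2 ∏ g` gives the
bound `3`, and with `∑ g - (k - 1) / 2` the bound `(2m + 1 - k) / (k - 1)`: what is left after
discarding the small bumps has norm at most `1`, respectively `(k - 1) / 2`.
-/

open Filter Set Topology
open scoped ENNReal Function NNReal

/-- **Rosenthal's lemma** -/
theorem exists_injective_forall_tsum_compl_le {ε : ℝ≥0∞} (hε : ε ≠ ⊤) (N : ℕ) (m : ℕ → ℕ → ℝ≥0∞)
    (hm : ∀ n, ∑' k, m n k ≤ N * ε) :
    ∃ φ : ℕ → ℕ, φ.Injective ∧ ∀ n, ∑' k : ({n}ᶜ : Set ℕ), m (φ n) (φ k) ≤ ε := by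
  induction N generalizing m with
  | zero =>
    refine ⟨id, Function.injective_id, fun n => ?_⟩
    calc ∑' k : ({n}ᶜ : Set ℕ), m n k ≤ ∑' k, m n k :=
          ENNReal.tsum_comp_le_tsum_of_injective Subtype.val_injective (m n)
      _ ≤ ε := (hm n).trans (by simp)
  | succ N ih =>
    let e : ℕ × ℕ ≃ ℕ := Nat.pairEquiv
    by_cases hrow : ∃ p, ∀ n, ∑' k : ({n}ᶜ : Set ℕ), m (e (p, n)) (e (p, k)) ≤ ε
    · obtain ⟨p, hp⟩ := hrow
      exact ⟨fun n => e (p, n), e.injective.comp (Prod.mk_right_injective p), hp⟩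
    push Not at hrow
    choose q hq using hrow
    -- Row `(p, q p)` has mass more than `ε` on block `p` off the transversal `r ↦ (r, q r)`,
    -- so it has mass at most `N * ε` on the transversal.
    have hinj : Function.Injective fun p => e (p, q p) :=
      fun a b hab => congrArg Prod.fst (e.injective hab)
    have htrans : ∀ p, ∑' p', m (e (p, q p)) (e (p', q p')) ≤ N * ε := fun p => by
      have hs : Function.Injective
          (Sum.elim (fun p' => e (p', q p')) fun k : ({q p}ᶜ : Set ℕ) => e (p, k)) :=
        hinj.sumElim (e.injective.comp ((Prod.mk_right_injective p).comp Subtype.val_injective))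
          fun p' k hk => by
            obtain ⟨rfl, hqk⟩ := Prod.mk.inj (e.injective hk)
            exact k.2 hqk.symm
      have htotal := ENNReal.tsum_comp_le_tsum_of_injective hs (m (e (p, q p)))
      rw [ENNReal.summable.tsum_sum ENNReal.summable] at htotal
      refine (ENNReal.add_le_add_iff_right hε).1 ?_
      calc ∑' p', m (e (p, q p)) (e (p', q p')) + ε
          ≤ ∑' k, m (e (p, q p)) k := (add_le_add_right (hq p).le _).trans htotal
        _ ≤ N * ε + ε := (hm _).trans_eq (by push_cast; ring)
    obtain ⟨φ, hφ, hle⟩ := ih _ htrans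
    exact ⟨fun n => e (φ n, q (φ n)), hinj.comp hφ, hle⟩

section CZero

variable {ι E F : Type*} [NormedAddCommGroup E] [NormedSpace ℝ E]
  [NormedAddCommGroup F] [NormedSpace ℝ F] {x : ι → E} {C : ℝ}

theorem embedsIsomorphically_of_mul_norm_le (J : E →L[ℝ] F) {c : ℝ} (hc : 0 < c)
    (hJ : ∀ v, c * ‖v‖ ≤ ‖J v‖) : EmbedsIsomorphically E F := by
  have hinv : ∀ v, ‖v‖ ≤ c⁻¹ * ‖J v‖ := fun v => (le_inv_mul_iff₀ hc).2 (hJ v)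
  have hinj : Function.Injective J := (injective_iff_map_eq_zero J).2 fun v hv =>
    norm_le_zero_iff.1 <| (hinv v).trans_eq (by simp [hv])
  let e := LinearEquiv.ofInjective (J : E →ₗ[ℝ] F) hinj
  refine ⟨_, ⟨e.toContinuousLinearEquivOfBounds ‖J‖ c⁻¹ J.le_opNorm fun w => ?_⟩⟩
  obtain ⟨v, rfl⟩ := e.surjective w
  simpa [e] using hinv v

/-- The series `∑ x n` is weakly unconditionally Cauchy, in the quantitative form: finite
combinations with coefficients in `[-1, 1]` have norm at most `C`. -/
def IsWUCWith (C : ℝ) (x : ι → E) : Prop :=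
  ∀ (s : Finset ι) (a : ι → ℝ), (∀ n ∈ s, |a n| ≤ 1) → ‖∑ n ∈ s, a n • x n‖ ≤ C

namespace IsWUCWith

theorem nonneg (hx : IsWUCWith C x) : 0 ≤ C := by
  simpa using hx ∅ 0

theorem comp_injective {κ : Type*} (hx : IsWUCWith C x) {φ : κ → ι} (hφ : φ.Injective) :
    IsWUCWith C (x ∘ φ) := fun s a ha => by
  classical
  simpa [hφ.extend_apply] using
    hx (s.map ⟨φ, hφ⟩) (Function.extend φ a 0) (by simpa [hφ.extend_apply] using ha)

theorem norm_sum_smul_le (hx : IsWUCWith C x) {s : Finset ι} {a : ι → ℝ} {r : ℝ} (hr : 0 ≤ r)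
    (ha : ∀ n ∈ s, |a n| ≤ r) : ‖∑ n ∈ s, a n • x n‖ ≤ C * r := by
  rcases hr.eq_or_lt with rfl | hr
  · rw [Finset.sum_eq_zero fun n hn => by rw [abs_nonpos_iff.1 (ha n hn), zero_smul]]
    simp
  have h := hx s (fun n => r⁻¹ * a n) fun n hn => by
    simpa [abs_mul, abs_of_pos hr, inv_mul_le_iff₀ hr] using ha n hn
  simp only [mul_smul, ← Finset.smul_sum, norm_smul, Real.norm_eq_abs, abs_of_pos (inv_pos.2 hr)]
    at h
  rwa [inv_mul_le_iff₀ hr, mul_comm] at h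

theorem sum_abs_apply_le (hx : IsWUCWith C x) (f : E →L[ℝ] ℝ) (s : Finset ι) :
    ∑ n ∈ s, |f (x n)| ≤ ‖f‖ * C := by
  have hsign : ∀ n ∈ s, |(SignType.sign (f (x n)) : ℝ)| ≤ 1 := fun n _ => by
    rcases lt_trichotomy (f (x n)) 0 with h | h | h <;> simp [h]
  calc ∑ n ∈ s, |f (x n)| = f (∑ n ∈ s, (SignType.sign (f (x n)) : ℝ) • x n) := by
        simp [map_sum, sign_mul_self]
    _ ≤ ‖f (∑ n ∈ s, (SignType.sign (f (x n)) : ℝ) • x n)‖ := Real.le_norm_self _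
    _ ≤ ‖f‖ * C := f.le_opNorm_of_le (hx s _ hsign)

theorem tsum_enorm_apply_le (hx : IsWUCWith C x) (f : E →L[ℝ] ℝ) :
    ∑' n, ‖f (x n)‖ₑ ≤ ENNReal.ofReal (‖f‖ * C) := by
  refine ENNReal.summable.tsum_le_of_sum_le fun s => ?_
  simp only [Real.enorm_eq_ofReal_abs]
  rw [← ENNReal.ofReal_sum_of_nonneg fun _ _ => abs_nonneg _]
  exact ENNReal.ofReal_le_ofReal (hx.sum_abs_apply_le f s)

end IsWUCWith

theorem abs_czero_apply_le_norm (a : C₀(ℕ, ℝ)) (n : ℕ) : |a n| ≤ ‖a‖ := by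
  rw [← ZeroAtInftyContinuousMap.norm_toBCF_eq_norm]
  exact a.toBCF.norm_coe_le_norm n

theorem norm_czero_le_iff {a : C₀(ℕ, ℝ)} {r : ℝ} (hr : 0 ≤ r) : ‖a‖ ≤ r ↔ ∀ n, |a n| ≤ r := by
  rw [← ZeroAtInftyContinuousMap.norm_toBCF_eq_norm]
  exact BoundedContinuousFunction.norm_le hr

namespace IsWUCWith

variable [CompleteSpace E] {x : ℕ → E}

theorem summable_smul (hx : IsWUCWith C x) (a : C₀(ℕ, ℝ)) : Summable fun n => a n • x n := by
  rw [summable_iff_vanishing_norm]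
  intro ε hε
  have hC := hx.nonneg
  have hr : 0 < ε / (C + 1) := by positivity
  have hlim : Tendsto a cofinite (𝓝 0) := by
    rw [← cocompact_eq_cofinite]
    exact a.zero_at_infty'
  have hsmall : ∀ᶠ n in cofinite, |a n| < ε / (C + 1) := by
    simpa using hlim.eventually (Metric.ball_mem_nhds 0 hr)
  refine ⟨hsmall.toFinset, fun s hs => ?_⟩
  have hsr : ∀ n ∈ s, |a n| ≤ ε / (C + 1) := fun n hn => by
    by_contra! h
    exact Finset.disjoint_left.1 hs hn ((Finite.mem_toFinset _).2 h.not_gt)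
  calc ‖∑ n ∈ s, a n • x n‖ ≤ C * (ε / (C + 1)) := hx.norm_sum_smul_le hr.le hsr
    _ < ε := by
      rw [mul_div_assoc', div_lt_iff₀ (by positivity)]
      linarith

theorem norm_tsum_smul_le (hx : IsWUCWith C x) (a : C₀(ℕ, ℝ)) :
    ‖∑' n, a n • x n‖ ≤ C * ‖a‖ :=
  le_of_tendsto (hx.summable_smul a).hasSum.norm <| .of_forall fun _ =>
    hx.norm_sum_smul_le (norm_nonneg a) fun n _ => abs_czero_apply_le_norm a n

/-- The operator `a ↦ ∑ a n • x n` from `c₀` attached to a weakly unconditionally Cauchy series. -/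
noncomputable def czeroOperator (hx : IsWUCWith C x) : C₀(ℕ, ℝ) →L[ℝ] E :=
  LinearMap.mkContinuous
    { toFun a := ∑' n, a n • x n
      map_add' a b := by
        simpa only [ZeroAtInftyContinuousMap.add_apply, add_smul] using
          (hx.summable_smul a).tsum_add (hx.summable_smul b)
      map_smul' c a := by
        simpa only [ZeroAtInftyContinuousMap.smul_apply, smul_assoc, RingHom.id_apply] using
          (hx.summable_smul a).tsum_const_smul c }
    C hx.norm_tsum_smul_le

theorem hasSum_czeroOperator (hx : IsWUCWith C x) (a : C₀(ℕ, ℝ)) :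
    HasSum (fun n => a n • x n) (hx.czeroOperator a) :=
  (hx.summable_smul a).hasSum

end IsWUCWith

theorem abs_tsum_compl_mul_le {ε : ℝ} (hε : 0 ≤ ε) {b : ℕ → ℝ} {n : ℕ}
    (hb : ∑' k : ({n}ᶜ : Set ℕ), ‖b k‖ₑ ≤ ENNReal.ofReal ε) (a : C₀(ℕ, ℝ)) :
    |∑' k : ({n}ᶜ : Set ℕ), a k * b k| ≤ ε * ‖a‖ := by
  rw [← ENNReal.ofReal_le_ofReal_iff (by positivity), ← Real.enorm_eq_ofReal_abs]
  calc ‖∑' k : ({n}ᶜ : Set ℕ), a k * b k‖ₑ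
      ≤ ∑' k : ({n}ᶜ : Set ℕ), ‖a k * b k‖ₑ := enorm_tsum_le_tsum_enorm
    _ ≤ ∑' k : ({n}ᶜ : Set ℕ), ENNReal.ofReal ‖a‖ * ‖b k‖ₑ := ENNReal.tsum_le_tsum fun k => by
        rw [enorm_mul, Real.enorm_eq_ofReal_abs (a k)]
        gcongr
        exact abs_czero_apply_le_norm a k
    _ ≤ ENNReal.ofReal ‖a‖ * ENNReal.ofReal ε := by rw [ENNReal.tsum_mul_left]; gcongr
    _ = ENNReal.ofReal (ε * ‖a‖) := by rw [mul_comm, ENNReal.ofReal_mul hε]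

theorem mul_norm_le_of_tsum_compl_le {u : ℕ → F} {a : C₀(ℕ, ℝ)} {v : F}
    (hv : HasSum (fun n => a n • u n) v) {f : ℕ → F →L[ℝ] ℝ} (hf : ∀ n, ‖f n‖ ≤ 1) {δ ε : ℝ}
    (hδ : 0 < δ) (hε : 0 ≤ ε) (hdiag : ∀ n, δ ≤ |f n (u n)|)
    (hoff : ∀ n, ∑' k : ({n}ᶜ : Set ℕ), ‖f n (u k)‖ₑ ≤ ENNReal.ofReal ε) :
    (δ - ε) * ‖a‖ ≤ ‖v‖ := by
  have hcoord : ∀ n, δ * |a n| ≤ ‖v‖ + ε * ‖a‖ := fun n => by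
    have hfv : HasSum (fun k => a k * f n (u k)) (f n v) := by simpa using (f n).hasSum hv
    have hsplit : a n * f n (u n) = f n v - ∑' k : ({n}ᶜ : Set ℕ), a k * f n (u k) := by
      rw [← hfv.tsum_eq, ← hfv.summable.tsum_subtype_add_tsum_subtype_compl {n}]
      simp
    calc δ * |a n| ≤ |a n * f n (u n)| := by
          rw [abs_mul, mul_comm]
          gcongr
          exact hdiag n
      _ ≤ |f n v| + |∑' k : ({n}ᶜ : Set ℕ), a k * f n (u k)| := hsplit ▸ abs_sub _ _
      _ ≤ ‖v‖ + ε * ‖a‖ := add_le_add (by simpa using (f n).le_of_opNorm_le (hf n) v)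
          (abs_tsum_compl_mul_le (b := fun k => f n (u k)) hε (hoff n) a)
  have hsup : ‖a‖ ≤ (‖v‖ + ε * ‖a‖) / δ := (norm_czero_le_iff (by positivity)).2 fun n => by
    rw [le_div_iff₀ hδ, mul_comm]
    exact hcoord n
  rw [le_div_iff₀ hδ] at hsup
  linarith

/-- **Bessaga–Pełczyński** -/
theorem IsWUCWith.containsCopyOfCZero [CompleteSpace E] {x : ℕ → E} (hx : IsWUCWith C x)
    (R : E →L[ℝ] F) {δ : ℝ} (hδ : 0 < δ) (hR : ∀ n, δ ≤ ‖R (x n)‖) : ContainsCopyOfCZero F := by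
  have hδ' : 0 < δ / 2 := half_pos hδ
  have hC := hx.nonneg
  choose f hf hfx using fun n => exists_dual_vector'' ℝ (R (x n))
  obtain ⟨N, hN⟩ := exists_nat_ge (‖R‖ * C / (δ / 2))
  have hrow : ∀ n, ∑' k, ‖f n (R (x k))‖ₑ ≤ N * ENNReal.ofReal (δ / 2) := fun n => by
    have hfR : ‖f n ∘L R‖ ≤ ‖R‖ :=
      ((f n).opNorm_comp_le R).trans (mul_le_of_le_one_left (norm_nonneg R) (hf n))
    refine (hx.tsum_enorm_apply_le (f n ∘L R)).trans ?_
    rw [← ENNReal.ofReal_natCast, ← ENNReal.ofReal_mul N.cast_nonneg]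
    refine ENNReal.ofReal_le_ofReal (le_trans ?_ ((div_le_iff₀ hδ').1 hN))
    gcongr
  obtain ⟨φ, hφ, hoff⟩ :=
    exists_injective_forall_tsum_compl_le ENNReal.ofReal_ne_top N _ hrow
  have hxφ := hx.comp_injective hφ
  refine embedsIsomorphically_of_mul_norm_le (R ∘L hxφ.czeroOperator) hδ' fun a => ?_
  have hsum : HasSum (fun n => a n • R (x (φ n))) (R (hxφ.czeroOperator a)) := by
    simpa using R.hasSum (hxφ.hasSum_czeroOperator a)
  have hdiag : ∀ n, δ ≤ |f (φ n) (R (x (φ n)))| := fun n => by simpa [hfx] using hR (φ n)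
  simpa [sub_half] using mul_norm_le_of_tsum_compl_le hsum (fun n => hf (φ n)) hδ hδ'.le hdiag hoff

end CZero

section Bumps

variable {X : Type*} [TopologicalSpace X] [CompactSpace X]

theorem isWUCWith_of_pairwise_disjoint_support {ι E : Type*} [NormedAddCommGroup E]
    [NormedSpace ℝ E] {g : ι → C(X, E)} (hg : ∀ n, ‖g n‖ ≤ 1)
    (hdisj : Pairwise (Disjoint on fun n => Function.support (g n))) : IsWUCWith 1 g :=
  fun s a ha => by
    classical
    refine (ContinuousMap.norm_le _ zero_le_one).2 fun z => ?_
    rw [ContinuousMap.sum_apply]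
    by_cases hz : ∃ n ∈ s, g n z ≠ 0
    · obtain ⟨n, hn, hgn⟩ := hz
      rw [Finset.sum_eq_single_of_mem n hn fun k _ hkn => by
        have hgk : g k z = 0 := by
          by_contra h
          exact disjoint_left.1 (hdisj hkn) h hgn
        simp [hgk]]
      rw [ContinuousMap.smul_apply, norm_smul]
      exact mul_le_one₀ (ha n hn) (norm_nonneg _) (((g n).norm_coe_le_norm z).trans (hg n))
    · push Not at hz
      rw [Finset.sum_eq_zero fun n hn => by simp [hz n hn]]
      simp

theorem finite_setOf_le_norm_of_pairwise_disjoint_support {ι E : Type*} [NormedAddCommGroup E]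
    [NormedSpace ℝ E] (hE : ¬ ContainsCopyOfCZero E) (R : C(X, ℝ) →L[ℝ] E) {g : ι → C(X, ℝ)}
    (hg : ∀ n, ‖g n‖ ≤ 1) (hdisj : Pairwise (Disjoint on fun n => Function.support (g n)))
    {δ : ℝ} (hδ : 0 < δ) : {n | δ ≤ ‖R (g n)‖}.Finite := by
  by_contra hinf
  let φ := Set.Infinite.natEmbedding _ hinf
  exact hE <| ((isWUCWith_of_pairwise_disjoint_support hg hdisj).comp_injective
    (Subtype.val_injective.comp φ.injective)).containsCopyOfCZero R hδ fun n => (φ n).2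

variable [T2Space X] {x : X} {A U : Set X}

theorem exists_bump_of_accPt (hx : AccPt x (𝓟 A)) (hU : U ∈ 𝓝 x) :
    ∃ g : C(X, ℝ), g ∈ Icc 0 1 ∧ tsupport g ⊆ U \ {x} ∧
      ∃ V, IsOpen V ∧ (V ∩ A).Nonempty ∧ EqOn g 1 V := by
  obtain ⟨p, ⟨hpU, hpA⟩, hpx⟩ := accPt_iff_nhds.1 hx (interior U) (interior_mem_nhds.2 hU)
  have hW : IsOpen (interior U \ {x}) := isOpen_interior.sdiff isClosed_singleton
  obtain ⟨t, htp, htc, htW⟩ := exists_mem_nhds_isClosed_subset (hW.mem_nhds ⟨hpU, hpx⟩)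
  obtain ⟨g, hsupp, hg1, hg⟩ :=
    exists_tsupport_one_of_isOpen_isClosed hW isClosed_closure.isCompact htc htW
  exact ⟨g, ⟨fun z => (hg z).1, fun z => (hg z).2⟩,
    hsupp.trans (sdiff_subset_sdiff_left interior_subset), interior t, isOpen_interior,
    ⟨p, mem_interior_iff_mem_nhds.2 htp, hpA⟩, hg1.mono interior_subset⟩

theorem exists_seq_bump_of_accPt (hx : AccPt x (𝓟 A)) (hU : U ∈ 𝓝 x) :
    ∃ g : ℕ → C(X, ℝ), Pairwise (Disjoint on fun n => Function.support (g n)) ∧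
      ∀ n, g n ∈ Icc 0 1 ∧ tsupport (g n) ⊆ U \ {x} ∧
        ∃ V, IsOpen V ∧ (V ∩ A).Nonempty ∧ EqOn (g n) 1 V := by
  let r (f g : C(X, ℝ)) : Prop := Disjoint (Function.support f) (Function.support g)
  have : Std.Symm r := ⟨fun _ _ h => Disjoint.symm h⟩
  let P (g : C(X, ℝ)) : Prop := g ∈ Icc 0 1 ∧ tsupport g ⊆ U \ {x} ∧
    ∃ V, IsOpen V ∧ (V ∩ A).Nonempty ∧ EqOn g 1 V
  have hstep : ∀ s : Finset C(X, ℝ), (∀ f ∈ s, P f) → ∃ g, P g ∧ ∀ f ∈ s, r f g := fun s hs => by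
    have hnhds : U ∩ ⋂ f ∈ s, (tsupport f)ᶜ ∈ 𝓝 x := inter_mem hU <|
      (Filter.biInter_finset_mem s).2 fun f hf =>
        (isClosed_tsupport f).isOpen_compl.mem_nhds fun hxf => ((hs f hf).2.1 hxf).2 rfl
    obtain ⟨g, hg, hsupp, hV⟩ := exists_bump_of_accPt hx hnhds
    refine ⟨g, ⟨hg, hsupp.trans (sdiff_subset_sdiff_left inter_subset_left), hV⟩, fun f hf => ?_⟩
    refine disjoint_left.2 fun z hzf hzg => ?_
    exact mem_iInter₂.1 (hsupp (subset_tsupport g hzg)).1.2 f hf (subset_tsupport f hzf)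
  obtain ⟨g, hg, hdisj⟩ := exists_seq_of_forall_finset_exists' P r hstep
  exact ⟨g, hdisj, hg⟩

end Bumps

section Accumulation

variable {X : Type*} [TopologicalSpace X]

theorem accPt_mem_iteratedDerivedSet_succ {A : Set X} {z : X} {n : ℕ}
    (hA : A ⊆ univᵈ[(n : Ordinal)]) (hz : AccPt z (𝓟 A)) :
    z ∈ (univ : Set X)ᵈ[((n + 1 : ℕ) : Ordinal)] := by
  rw [Nat.cast_succ, CantorBendixson.iteratedDerivedSet_succ,
    (CantorBendixson.isClosed_iteratedDerivedSet isClosed_univ _).relDerivedSet_eq]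
  exact hz.mono (principal_mono.2 hA)

theorem exists_mem_iteratedDerivedSet_succ_dist_lt {ι M : Type*} [Infinite ι] [CompactSpace X]
    [PseudoMetricSpace M] {φ : X → M} (hφ : Continuous φ) {y : ι → X}
    (hfib : ∀ z, (y ⁻¹' {z}).Finite) {s : ℕ} {c : ι → ℕ} (hc : ∀ n, c n ≤ s)
    (hy : ∀ n, y n ∈ (univ : Set X)ᵈ[(c n : Ordinal)]) {η : ℝ} (hη : 0 < η) :
    ∃ n, ∃ z ∈ (univ : Set X)ᵈ[((c n + 1 : ℕ) : Ordinal)], dist (φ z) (φ (y n)) < η := by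
  obtain ⟨j, hj⟩ := Finite.exists_infinite_fiber fun n : ι =>
    (⟨c n, Nat.lt_succ_of_le (hc n)⟩ : Fin (s + 1))
  have hinf : (y '' {n | c n = j}).Infinite := fun hfin => by
    refine (hfin.preimage' fun z _ => hfib z).not_infinite ((infinite_coe_iff.1 hj).mono ?_)
    exact fun n hn => mem_image_of_mem y (congrArg Fin.val hn)
  obtain ⟨z, hz⟩ := hinf.exists_accPt_principal
  have hball : φ ⁻¹' Metric.ball (φ z) η ∈ 𝓝 z :=
    hφ.continuousAt.preimage_mem_nhds (Metric.ball_mem_nhds _ hη)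
  obtain ⟨_, ⟨hn, n, hcn, rfl⟩, -⟩ := accPt_iff_nhds.1 hz _ hball
  refine ⟨n, z, accPt_mem_iteratedDerivedSet_succ ?_ hz, Metric.mem_ball'.1 hn⟩
  rintro _ ⟨k, hk, rfl⟩
  exact hk.trans hcn.symm ▸ hy k

end Accumulation

section Lists

variable {R : Type*} [PartialOrder R]

theorem list_prod_mem_Icc [Semiring R] [IsOrderedRing R] {l : List R}
    (hl : ∀ a ∈ l, a ∈ Icc (0 : R) 1) : l.prod ∈ Icc (0 : R) 1 :=
  List.prod_induction (· ∈ Icc (0 : R) 1)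
    (fun _ _ ha hb => ⟨mul_nonneg ha.1 hb.1, mul_le_one₀ ha.2 hb.1 hb.2⟩)
    ⟨zero_le_one, le_rfl⟩ hl

theorem list_prod_le_of_mem [CommSemiring R] [IsOrderedRing R] {l : List R} {a : R}
    (hl : ∀ a ∈ l, a ∈ Icc (0 : R) 1) (ha : a ∈ l) : l.prod ≤ a := by
  classical
  rw [← List.prod_erase ha]
  exact mul_le_of_le_one_right (hl a ha).1
    (list_prod_mem_Icc fun b hb => hl b (List.mem_of_mem_erase hb)).2

theorem list_sum_mem_Icc_length [Semiring R] [IsOrderedRing R] {l : List R}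
    (hl : ∀ a ∈ l, a ∈ Icc (0 : R) 1) : l.sum ∈ Icc (0 : R) l.length :=
  ⟨List.sum_nonneg fun a ha => (hl a ha).1,
    by simpa using List.sum_le_card_nsmul l 1 fun a ha => (hl a ha).2⟩

theorem norm_map_list_sum_le {M E F : Type*} [AddMonoid M] [SeminormedAddCommGroup E]
    [FunLike F M E] [AddMonoidHomClass F M E] (f : F) {l : List M} {δ : ℝ}
    (hl : ∀ a ∈ l, ‖f a‖ ≤ δ) : ‖f l.sum‖ ≤ l.length * δ :=
  calc ‖f l.sum‖ ≤ (l.map fun a => ‖f a‖).sum :=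
        List.le_sum_of_subadditive (fun a => ‖f a‖) (by simp)
          (fun a b => by simpa using norm_add_le (f a) (f b)) l
    _ ≤ l.length * δ := by simpa using List.sum_le_card_nsmul (l.map fun a => ‖f a‖) δ (by simpa)

end Lists

theorem le_of_forall_pos_le_add_mul {a b c : ℝ} (h : ∀ δ > 0, a ≤ b + δ * c) : a ≤ b := by
  have hlim : Tendsto (fun δ : ℝ => b + δ * c) (𝓝[>] 0) (𝓝 (b + 0 * c)) :=
    ((continuous_id.mul continuous_const).const_add b).continuousWithinAt
  simpa using ge_of_tendsto hlim (eventually_mem_of_tendsto_nhdsWithin tendsto_id |>.mono h)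

section Sup

variable {X E : Type*} [TopologicalSpace X]

theorem list_prod_apply_eq_one {l : List C(X, ℝ)} {p : X} (hl : ∀ g ∈ l, g p = 1) :
    l.prod p = 1 := by
  induction l with
  | nil => simp
  | cons g l ih =>
    rw [List.forall_mem_cons] at hl
    simp [hl.1, ih hl.2]

theorem list_sum_apply_eq_length {l : List C(X, ℝ)} {p : X} (hl : ∀ g ∈ l, g p = 1) :
    l.sum p = l.length := by
  induction l with
  | nil => simp
  | cons g l ih =>
    rw [List.forall_mem_cons] at hl
    simp [hl.1, ih hl.2, add_comm]

variable [CompactSpace X]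

theorem exists_norm_apply_eq_norm [Nonempty X] [SeminormedAddCommGroup E] (f : C(X, E)) :
    ∃ y, ‖f y‖ = ‖f‖ := by
  obtain ⟨y, -, hy⟩ := isCompact_univ.exists_isMaxOn univ_nonempty f.continuous.norm.continuousOn
  exact ⟨y, le_antisymm (f.norm_coe_le_norm y) <|
    (ContinuousMap.norm_le _ (norm_nonneg _)).2 fun z => hy (mem_univ z)⟩

theorem norm_le_one_of_mem_Icc {f : C(X, ℝ)} (hf : f ∈ Icc 0 1) : ‖f‖ ≤ 1 :=
  (ContinuousMap.norm_le _ zero_le_one).2 fun z => (abs_of_nonneg (hf.1 z)).trans_le (hf.2 z)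

theorem norm_list_sum_sub_smul_one_le {l : List C(X, ℝ)} {h : ℝ} (hl : ∀ g ∈ l, g ∈ Icc 0 1)
    (hlen : (l.length : ℝ) ≤ 2 * h) : ‖l.sum - h • 1‖ ≤ h := by
  have hh : 0 ≤ h := by linarith [(Nat.cast_nonneg _ : (0 : ℝ) ≤ l.length)]
  refine (ContinuousMap.norm_le _ hh).2 fun z => abs_le.2 ?_
  have hmem := list_sum_mem_Icc_length hl
  have hlo : 0 ≤ l.sum z := hmem.1 z
  have hhi : l.sum z ≤ l.length := hmem.2 z
  simp only [ContinuousMap.sub_apply, ContinuousMap.smul_apply, ContinuousMap.one_apply,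
    smul_eq_mul]
  constructor <;> linarith

theorem norm_le_mul_of_norm_apply_eq_norm {V : Type*} [NormedAddCommGroup V] [NormedSpace ℝ V]
    [NormedAddCommGroup E] [NormedSpace ℝ E] {S : V →L[ℝ] C(X, E)} {B : ℝ≥0}
    (hS : AntilipschitzWith B S) {f : V} {y : X} (hy : ‖S f y‖ = ‖S f‖) (b : V) :
    ‖f‖ ≤ B * (‖S‖ * ‖b‖ + ‖S (f - b) y‖) := by
  refine (ZeroHomClass.bound_of_antilipschitz S hS f).trans ?_
  gcongr
  calc ‖S f‖ = ‖S b y + S (f - b) y‖ := by simp [hy]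
    _ ≤ ‖S b y‖ + ‖S (f - b) y‖ := norm_add_le _ _
    _ ≤ ‖S‖ * ‖b‖ + ‖S (f - b) y‖ := by
      gcongr
      exact ((S b).norm_coe_le_norm y).trans (S.le_opNorm b)

end Sup

section Chain

universe u

variable {K₁ K₂ : Type*} {E : Type u} [TopologicalSpace K₁] [TopologicalSpace K₂]
  [NormedAddCommGroup E] [NormedSpace ℝ E]

/-- The number of entries of `gs` whose image under `S` has norm at least `δ` at the point `y`. It
counts the derivatives of `K₂` passed while the chain of bumps `gs` is being built. -/
noncomputable def largeCount (S : C(K₁, ℝ) →L[ℝ] C(K₂, E)) (δ : ℝ) (y : K₂)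
    (gs : List C(K₁, ℝ)) : ℕ :=
  gs.countP fun g => δ ≤ ‖S g y‖

variable (hE : ¬ ContainsCopyOfCZero E) (S : C(K₁, ℝ) →L[ℝ] C(K₂, E)) {δ : ℝ} (hδ : 0 < δ)

theorem largeCount_cons (y : K₂) (g : C(K₁, ℝ)) (gs : List C(K₁, ℝ)) :
    largeCount S δ y (g :: gs) = largeCount S δ y gs + if δ ≤ ‖S g y‖ then 1 else 0 := by
  simp [largeCount, List.countP_cons]

variable [CompactSpace K₁]
include hE hδ

theorem finite_setOf_le_norm_apply_of_pairwise_disjoint_support {ι : Type*} {g : ι → C(K₁, ℝ)}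
    (hg : ∀ n, ‖g n‖ ≤ 1) (hdisj : Pairwise (Disjoint on fun n => Function.support (g n)))
    (z : K₂) : {n | δ ≤ ‖S (g n) z‖}.Finite :=
  finite_setOf_le_norm_of_pairwise_disjoint_support hE (ContinuousMap.evalCLM ℝ z ∘L S) hg hdisj hδ

variable [CompactSpace K₂]

theorem exists_deeper_point {M : Type*} [PseudoMetricSpace M] {φ : K₂ → M} (hφ : Continuous φ)
    {g : ℕ → C(K₁, ℝ)} (hg : ∀ n, ‖g n‖ ≤ 1)
    (hdisj : Pairwise (Disjoint on fun n => Function.support (g n))) {s : ℕ} {c : ℕ → ℕ}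
    (hc : ∀ n, c n ≤ s) {q y : ℕ → K₂} (hy : ∀ n, y n ∈ (univ : Set K₂)ᵈ[(c n : Ordinal)])
    (hSy : ∀ n, dist (S (g n) (y n)) (S (g n) (q n)) < δ / 2)
    {η : ℝ} (hη : 0 < η) (hφy : ∀ n, dist (φ (y n)) (φ (q n)) < η / 2) :
    ∃ n, ∃ z ∈ (univ : Set K₂)ᵈ[((c n + if δ ≤ ‖S (g n) (q n)‖ then 1 else 0 : ℕ) : Ordinal)],
      dist (φ z) (φ (q n)) < η := by
  by_cases hsmall : ∃ n, ‖S (g n) (q n)‖ < δ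
  · obtain ⟨n, hn⟩ := hsmall
    refine ⟨n, y n, by simpa [hn.not_ge] using hy n, (hφy n).trans (half_lt_self hη)⟩
  push Not at hsmall
  have hbig : ∀ n, δ / 2 ≤ ‖S (g n) (y n)‖ := fun n => by
    have hdist := dist_eq_norm' (S (g n) (y n)) (S (g n) (q n)) ▸ hSy n
    linarith [hsmall n, norm_sub_norm_le (S (g n) (q n)) (S (g n) (y n))]
  have hfib : ∀ z, (y ⁻¹' {z}).Finite := fun z => by
    refine (finite_setOf_le_norm_apply_of_pairwise_disjoint_support hE S (half_pos hδ) hg hdisj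
      z).subset ?_
    rintro n rfl
    exact hbig n
  obtain ⟨n, z, hz, hzy⟩ :=
    exists_mem_iteratedDerivedSet_succ_dist_lt hφ hfib hc hy (half_pos hη)
  refine ⟨n, z, by simpa [hsmall n] using hz, ?_⟩
  calc dist (φ z) (φ (q n)) ≤ dist (φ z) (φ (y n)) + dist (φ (y n)) (φ (q n)) :=
        dist_triangle _ _ _
    _ < η := by linarith [hφy n]

variable [T2Space K₁]

-- The point `F gs` is only known once the whole list `gs` has been chosen; the auxiliary map `φ`
-- lets the induction carry along the values at the later points of the bumps already chosen.
theorem exists_chain_and_mem_iteratedDerivedSet (s : ℕ) {M : Type u} [PseudoMetricSpace M]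
    {φ : K₂ → M} (hφ : Continuous φ) (F : List C(K₁, ℝ) → K₂) {x : K₁} {U : Set K₁}
    (hx : x ∈ (univ : Set K₁)ᵈ[(s : Ordinal)]) (hU : U ∈ 𝓝 x) {η : ℝ} (hη : 0 < η) :
    ∃ gs : List C(K₁, ℝ), gs.length = s ∧ (∀ g ∈ gs, g ∈ Icc 0 1) ∧
      (∃ p ∈ U, ∀ g ∈ gs, g p = 1) ∧
      ∃ y ∈ (univ : Set K₂)ᵈ[(largeCount S δ (F gs) gs : Ordinal)], dist (φ y) (φ (F gs)) < η := by
  induction s generalizing M F x U η with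
  | zero =>
    exact ⟨[], rfl, by simp, ⟨x, mem_of_mem_nhds hU, by simp⟩, F [], by simp [largeCount],
      by simpa using hη⟩
  | succ s ih =>
    rw [Nat.cast_succ, CantorBendixson.iteratedDerivedSet_succ] at hx
    obtain ⟨g, hdisj, hbump⟩ := exists_seq_bump_of_accPt (mem_derivedSet.1 hx.1) hU
    choose hg hgU V hV hVne hgV using hbump
    choose p hp using hVne
    have hφS : ∀ n, Continuous fun z => (φ z, S (g n) z) := fun n => by fun_prop
    choose gs hlen hgs hpeak y hy hdist using fun n =>
      ih (hφS n) (fun l => F (g n :: l)) (hp n).2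
        ((hV n).mem_nhds (hp n).1) (lt_min (half_pos hη) (half_pos hδ))
    choose q hqV hq using hpeak
    have hcount : ∀ n, largeCount S δ (F (g n :: gs n)) (gs n) ≤ s := fun n =>
      List.countP_le_length.trans (hlen n).le
    have hclose : ∀ n, dist (φ (y n)) (φ (F (g n :: gs n))) < η / 2 ∧
        dist (S (g n) (y n)) (S (g n) (F (g n :: gs n))) < δ / 2 := fun n => by
      obtain ⟨hφn, hSn⟩ := max_lt_iff.1 (hdist n)
      exact ⟨hφn.trans_le (min_le_left _ _), hSn.trans_le (min_le_right _ _)⟩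
    obtain ⟨n, z, hz, hzη⟩ := exists_deeper_point hE S hδ hφ
      (fun n => norm_le_one_of_mem_Icc (hg n)) hdisj hcount hy (fun n => (hclose n).2) hη
      fun n => (hclose n).1
    have hgq : g n (q n) = 1 := hgV n (hqV n)
    refine ⟨g n :: gs n, by simp [hlen], List.forall_mem_cons.2 ⟨hg n, hgs n⟩,
      ⟨q n, (hgU n (subset_tsupport _ ?_)).1, List.forall_mem_cons.2 ⟨hgq, hq n⟩⟩, z, ?_, hzη⟩
    · simp [hgq]
    · rwa [largeCount_cons]

theorem exists_chain_largeCount_lt [Nonempty K₂] {m k : ℕ}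
    (h₁ : ((univ : Set K₁)ᵈ[(m : Ordinal)]).Nonempty) (h₂ : (univ : Set K₂)ᵈ[(k : Ordinal)] = ∅)
    (f : List C(K₁, ℝ) → C(K₁, ℝ)) :
    ∃ (gs : List C(K₁, ℝ)) (p : K₁) (y : K₂), gs.length = m ∧
      (∀ g ∈ gs, g ∈ Icc 0 1 ∧ g p = 1) ∧ largeCount S δ y gs < k ∧ ‖S (f gs) y‖ = ‖S (f gs)‖ := by
  choose F hF using fun gs => exists_norm_apply_eq_norm (S (f gs))
  obtain ⟨x, hx⟩ := h₁
  obtain ⟨gs, hlen, hgs, ⟨p, -, hp⟩, y, hy, -⟩ :=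
    exists_chain_and_mem_iteratedDerivedSet hE S hδ m (continuous_const (y := (0 : E))) F hx
      univ_mem one_pos
  refine ⟨gs, p, F gs, hlen, fun g hg => ⟨hgs g hg, hp g hg⟩, ?_, hF gs⟩
  by_contra! hk
  exact (h₂ ▸ CantorBendixson.iteratedDerivedSet_antitone univ (Nat.cast_le.2 hk) hy :
    y ∈ (∅ : Set K₂))

omit hδ

variable {S} [Nonempty K₂] {B : ℝ≥0} (hS : AntilipschitzWith B S) {m k : ℕ}
  (h₁ : ((univ : Set K₁)ᵈ[(m : Ordinal)]).Nonempty) (h₂ : (univ : Set K₂)ᵈ[(k : Ordinal)] = ∅)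

include hS h₁ h₂

theorem three_le_opNorm_mul (hkm : k ≤ m) : 3 ≤ ‖S‖ * B := by
  refine le_of_forall_pos_le_add_mul (c := 2 * B) fun δ hδ => ?_
  obtain ⟨gs, p, y, hlen, hgs, hcount, hy⟩ :=
    exists_chain_largeCount_lt hE S hδ h₁ h₂ fun gs => 1 + (2 : ℝ) • gs.prod
  obtain ⟨g, hg, hsmall⟩ : ∃ g ∈ gs, ‖S g y‖ < δ := by
    by_contra! hlarge
    have : largeCount S δ y gs = gs.length := List.countP_eq_length.2 (by simpa using hlarge)
    omega
  have hnorm : 3 ≤ ‖1 + (2 : ℝ) • gs.prod‖ := by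
    have hprod : gs.prod p = 1 := list_prod_apply_eq_one fun g hg => (hgs g hg).2
    refine le_trans ?_ ((Real.le_norm_self _).trans (ContinuousMap.norm_coe_le_norm _ p))
    norm_num [hprod]
  have hdiff : ‖1 + (2 : ℝ) • gs.prod - (2 : ℝ) • g‖ ≤ 1 := by
    refine (ContinuousMap.norm_le _ zero_le_one).2 fun z => abs_le.2 ?_
    have hle : gs.prod z ≤ g z := list_prod_le_of_mem (fun g hg => (hgs g hg).1) hg z
    have hpos : 0 ≤ gs.prod z := (list_prod_mem_Icc fun g hg => (hgs g hg).1).1 z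
    have hone : g z ≤ 1 := (hgs g hg).1.2 z
    simp only [ContinuousMap.sub_apply, ContinuousMap.add_apply, ContinuousMap.one_apply,
      ContinuousMap.smul_apply, smul_eq_mul]
    constructor <;> linarith
  calc 3 ≤ ‖1 + (2 : ℝ) • gs.prod‖ := hnorm
    _ ≤ B * (‖S‖ * ‖1 + (2 : ℝ) • gs.prod - (2 : ℝ) • g‖ + ‖S ((2 : ℝ) • g) y‖) := by
      simpa only [sub_sub_cancel] using norm_le_mul_of_norm_apply_eq_norm hS hy
        (1 + (2 : ℝ) • gs.prod - (2 : ℝ) • g)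
    _ ≤ B * (‖S‖ * 1 + 2 * δ) := by
      rw [map_smul, ContinuousMap.smul_apply, norm_smul, Real.norm_two]
      gcongr
    _ = ‖S‖ * B + δ * (2 * B) := by ring

theorem sub_half_le_opNorm_mul :
    m - ((k : ℝ) - 1) / 2 ≤ ‖S‖ * B * (((k : ℝ) - 1) / 2) := by
  set h : ℝ := ((k : ℝ) - 1) / 2 with hh
  refine le_of_forall_pos_le_add_mul (c := m * B) fun δ hδ => ?_
  obtain ⟨gs, p, y, hlen, hgs, hcount, hy⟩ :=
    exists_chain_largeCount_lt hE S hδ h₁ h₂ fun gs => gs.sum - h • 1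
  let large : C(K₁, ℝ) → Bool := fun g => δ ≤ ‖S g y‖
  have hsplit : (gs.filter large).sum + (gs.filter fun g => !large g).sum = gs.sum := by
    simpa using List.sum_map_filter_add_sum_map_filter_not (fun g => large g) id gs
  have hlarge : ((gs.filter large).length : ℝ) ≤ 2 * h := by
    have : (largeCount S δ y gs : ℝ) + 1 ≤ k := by exact_mod_cast hcount
    rw [← List.countP_eq_length_filter]
    exact le_of_le_of_eq (le_sub_iff_add_le.2 this) (by rw [hh]; ring)
  have hnorm : m - h ≤ ‖gs.sum - h • 1‖ := by
    refine le_trans ?_ ((Real.le_norm_self _).trans (ContinuousMap.norm_coe_le_norm _ p))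
    simp [list_sum_apply_eq_length fun g hg => (hgs g hg).2, hlen]
  have hcentre : ‖(gs.filter large).sum - h • 1‖ ≤ h :=
    norm_list_sum_sub_smul_one_le (fun g hg => (hgs g (List.mem_of_mem_filter hg)).1) hlarge
  have hsmall : ‖S (gs.filter fun g => !large g).sum y‖ ≤ m * δ := by
    refine (norm_map_list_sum_le (δ := δ) (ContinuousMap.evalCLM ℝ y ∘L S) fun g hg => ?_).trans ?_
    · have hlt := List.of_mem_filter hg
      simp only [large, Bool.not_eq_true', decide_eq_false_iff_not, not_le] at hlt
      exact hlt.le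
    · rw [← hlen]
      gcongr
      exact List.length_filter_le _ _
  calc m - h ≤ ‖gs.sum - h • 1‖ := hnorm
    _ ≤ B * (‖S‖ * ‖(gs.filter large).sum - h • 1‖ + ‖S (gs.filter fun g => !large g).sum y‖) := by
      simpa only [← hsplit, sub_sub_sub_cancel_right, add_sub_cancel_left] using
        norm_le_mul_of_norm_apply_eq_norm hS hy ((gs.filter large).sum - h • 1)
    _ ≤ B * (‖S‖ * h + m * δ) := by gcongr
    _ = ‖S‖ * B * h + δ * (m * B) := by ring

end Chain

section Height

variable {X : Type*} [TopologicalSpace X]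

theorem IsScatteredSpace.iteratedDerivedSet_scatteredHeight (hX : IsScatteredSpace X) :
    (univ : Set X)ᵈ[scatteredHeight X] = ∅ :=
  csInf_mem hX

theorem scatteredHeight_le {α : Ordinal} (hα : (univ : Set X)ᵈ[α] = ∅) : scatteredHeight X ≤ α :=
  csInf_le' hα

theorem iteratedDerivedSet_nonempty_of_lt_scatteredHeight {α : Ordinal}
    (hα : α < scatteredHeight X) : ((univ : Set X)ᵈ[α]).Nonempty :=
  nonempty_iff_ne_empty.2 fun h => (scatteredHeight_le h).not_gt hα

theorem one_lt_of_iteratedDerivedSet_eq_empty [CompactSpace X] [Infinite X] {k : ℕ}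
    (hk : (univ : Set X)ᵈ[(k : Ordinal)] = ∅) : 1 < k := by
  obtain ⟨z, hz⟩ := (infinite_univ (α := X)).exists_accPt_principal
  have hz₁ : z ∈ (univ : Set X)ᵈ[((0 + 1 : ℕ) : Ordinal)] :=
    accPt_mem_iteratedDerivedSet_succ (by simp) hz
  by_contra! hk₁
  exact (hk ▸ CantorBendixson.iteratedDerivedSet_antitone univ (Nat.cast_le.2 hk₁) hz₁ :
    z ∈ (∅ : Set X))

end Height

section ScalarRestriction

variable {K₁ K₂ E₁ E₂ : Type*} [TopologicalSpace K₁] [CompactSpace K₁] [TopologicalSpace K₂]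
  [CompactSpace K₂] [NormedAddCommGroup E₁] [NormedSpace ℝ E₁] [Nontrivial E₁]
  [NormedAddCommGroup E₂] [NormedSpace ℝ E₂]

theorem exists_linearIsometry_continuousMap_real (X E : Type*) [TopologicalSpace X]
    [CompactSpace X] [NormedAddCommGroup E] [NormedSpace ℝ E] [Nontrivial E] :
    Nonempty (C(X, ℝ) →ₗᵢ[ℝ] C(X, E)) := by
  obtain ⟨e, he⟩ := exists_norm_eq E (zero_le_one' ℝ)
  let J := (ContinuousLinearMap.toSpanSingleton ℝ e).compLeftContinuous ℝ X
  have hJ : ∀ f z, ‖J f z‖ = ‖f z‖ := fun f z => by simp [J, norm_smul, he]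
  exact ⟨J.toLinearMap, fun f => by simp [ContinuousMap.norm_eq_iSup_norm, hJ]⟩

theorem exists_antilipschitzWith_of_equiv {H : Submodule ℝ C(K₂, E₂)} (T : C(K₁, E₁) ≃L[ℝ] H) :
    ∃ S : C(K₁, ℝ) →L[ℝ] C(K₂, E₂), ‖S‖ ≤ ‖(T : C(K₁, E₁) →L[ℝ] H)‖ ∧
      AntilipschitzWith ‖(T.symm : H →L[ℝ] C(K₁, E₁))‖₊ S := by
  obtain ⟨J⟩ := exists_linearIsometry_continuousMap_real K₁ E₁
  refine ⟨H.subtypeL ∘L (T : C(K₁, E₁) →L[ℝ] H) ∘L J.toContinuousLinearMap,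
    ContinuousLinearMap.opNorm_le_bound _ (ContinuousLinearMap.opNorm_nonneg _) fun f => ?_, ?_⟩
  · simpa using (T : C(K₁, E₁) →L[ℝ] H).le_opNorm (J f)
  · have hcomp := (H.subtypeₗᵢ.antilipschitz.comp T.antilipschitz).comp J.antilipschitz
    rwa [mul_one, one_mul] at hcomp

end ScalarRestriction

theorem corollary1p5_general
    (K₁ : Type*) [TopologicalSpace K₁] [CompactSpace K₁] [T2Space K₁]
    (K₂ : Type*) [TopologicalSpace K₂] [CompactSpace K₂] [Infinite K₂]
    (E₁ : Type*) [NormedAddCommGroup E₁] [NormedSpace ℝ E₁] [Nontrivial E₁]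
    (E₂ : Type*) [NormedAddCommGroup E₂] [NormedSpace ℝ E₂]
    (hE₂ : ¬ ContainsCopyOfCZero E₂) :
    (∀ l k : ℕ, k < l →
      IsScatteredSpace K₁ → scatteredHeight K₁ = l →
      IsScatteredSpace K₂ → scatteredHeight K₂ = k →
      ∀ (H : Submodule ℝ C(K₂, E₂)) (T : C(K₁, E₁) ≃L[ℝ] H),
        max 3 ((2 * (l : ℝ) - k - 1) / ((k : ℝ) - 1)) ≤
          ‖(T : C(K₁, E₁) →L[ℝ] H)‖ * ‖(T.symm : H →L[ℝ] C(K₁, E₁))‖) ∧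
    (EmbedsIsomorphically C(K₁, E₁) C(K₂, E₂) →
      IsScatteredSpace K₂ → scatteredHeight K₂ < Ordinal.omega0 →
      IsScatteredSpace K₁ ∧ scatteredHeight K₁ < Ordinal.omega0) := by
  refine ⟨fun l k hkl _ hl hs₂ hk H T => ?_, fun ⟨H, ⟨T⟩⟩ hs₂ hht => ?_⟩
  all_goals obtain ⟨S, hST, hS⟩ := exists_antilipschitzWith_of_equiv T
  · have h₂ : (univ : Set K₂)ᵈ[(k : Ordinal)] = ∅ := hk ▸ hs₂.iteratedDerivedSet_scatteredHeight
    obtain ⟨m, rfl⟩ := Nat.exists_eq_succ_of_ne_zero (Nat.ne_zero_of_lt hkl)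
    have h₁ : ((univ : Set K₁)ᵈ[(m : Ordinal)]).Nonempty :=
      iteratedDerivedSet_nonempty_of_lt_scatteredHeight (hl ▸ Nat.cast_lt.2 m.lt_succ_self)
    have hk₁ : (1 : ℝ) < k := Nat.one_lt_cast.2 (one_lt_of_iteratedDerivedSet_eq_empty h₂)
    refine le_trans (max_le (three_le_opNorm_mul hE₂ hS h₁ h₂ (Nat.lt_succ_iff.1 hkl)) ?_)
      (mul_le_mul_of_nonneg_right hST (norm_nonneg _))
    rw [div_le_iff₀ (sub_pos.2 hk₁)]
    have hest := sub_half_le_opNorm_mul hE₂ hS h₁ h₂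
    push_cast at hest ⊢
    linarith
  · obtain ⟨k, hk⟩ := Ordinal.lt_omega0.1 hht
    have h₂ : (univ : Set K₂)ᵈ[(k : Ordinal)] = ∅ := hk ▸ hs₂.iteratedDerivedSet_scatteredHeight
    obtain ⟨m, hm⟩ := exists_nat_gt
      (‖S‖ * ‖(T.symm : H →L[ℝ] C(K₁, E₁))‖ * (((k : ℝ) - 1) / 2) + ((k : ℝ) - 1) / 2)
    have h₁ : (univ : Set K₁)ᵈ[(m : Ordinal)] = ∅ := by
      by_contra! h₁
      have hest := sub_half_le_opNorm_mul hE₂ hS h₁ h₂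
      rw [coe_nnnorm] at hest
      linarith
    exact ⟨⟨m, h₁⟩, (scatteredHeight_le h₁).trans_lt (Ordinal.natCast_lt_omega0 m)⟩

theorem corollary1p5
    (K₁ : Type*) [TopologicalSpace K₁] [CompactSpace K₁] [T2Space K₁] [Infinite K₁]
    (K₂ : Type*) [TopologicalSpace K₂] [CompactSpace K₂] [T2Space K₂] [Infinite K₂]
    (E₁ : Type*) [NormedAddCommGroup E₁] [NormedSpace ℝ E₁] [CompleteSpace E₁] [Nontrivial E₁]
    (E₂ : Type*) [NormedAddCommGroup E₂] [NormedSpace ℝ E₂] [CompleteSpace E₂] [Nontrivial E₂]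
    (hE₂ : ¬ ContainsCopyOfCZero E₂) :
    -- (i) an into isomorphism is a linear homeomorphism `T` onto a subspace `H` of `C(K₂, E₂)`
    (∀ l k : ℕ, k < l →
      IsScatteredSpace K₁ → scatteredHeight K₁ = l →
      IsScatteredSpace K₂ → scatteredHeight K₂ = k →
      ∀ (H : Submodule ℝ C(K₂, E₂)) (T : C(K₁, E₁) ≃L[ℝ] H),
        max 3 ((2 * (l : ℝ) - k - 1) / ((k : ℝ) - 1)) ≤
          ‖(T : C(K₁, E₁) →L[ℝ] H)‖ * ‖(T.symm : H →L[ℝ] C(K₁, E₁))‖) ∧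
    -- (ii)
    (EmbedsIsomorphically C(K₁, E₁) C(K₂, E₂) →
      IsScatteredSpace K₂ → scatteredHeight K₂ < Ordinal.omega0 →
      IsScatteredSpace K₁ ∧ scatteredHeight K₁ < Ordinal.omega0) :=
  corollary1p5_general K₁ K₂ E₁ E₂ hE₂
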